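/- Fix $q\in\mathbb C$ with $0<|q|<1$ and a value of $\log q$. Let $\kappa_1,\kappa_2,\theta_1,\theta_2\in\mathbb C\setminus\{0\}$, with chosen logarithms, satisfy $\kappa_j/\kappa_k,\ \theta_j/\theta_k\notin\{q,q^2,q^3,\dots\}$ for all $j,k$, and let $a_1,\dots,a_4\in\mathbb C$; all of these are independent of $t$. Let $t$ range over a set $T$ of points of the universal cover of $\mathbb C\setminus\{0\}$ (so that $\log t$ is given, and $\log(qt)=\log q+\log t$). For $t\in T$ let $$A(x,t)=A_0(t)+A_1(t)x+A_2x^2,\qquad A_2=\mathrm{diag}(\kappa_1,\kappa_2),$$ be $2\times2$ complex matrices such that $$A_0(t)=C_0(t)\,\mathrm{diag}(t\theta_1,t\theta_2)\,C_0(t)^{-1}\ \text{ with } C_0(t) \text{ invertible},\qquad \det A(x,t)=\kappa_1\kappa_2(x-ta_1)(x-ta_2)(x-a_3)(x-a_4).$$ For every $t$ with $t,qt\in T$ assume that the zeros are generic in the following sense: $a_1/a_2\notin\{q^n: n\in\mathbb Z,\ |n|\ge2\}$, $a_3/a_4\notin\{q^n: n\in\mathbb Z,\ n\ne0\}$, and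 $ta_i/a_j\notin\{q^n: n\in\mathbb Z,\ n\ne0,-1\}$ for $i\in\{1,2\}$, $j\in\{3,4\}$. Let $$Y_0(x,t)=\widehat Y_0(x,t)\,x^{D_0(t)},\qquad Y_\infty(x,t)=q^{u(u-1)}\,\widehat Y_\infty(x,t)\,x^{D_\infty},\qquad u=\frac{\log x}{\log q},$$ with $$D_0(t)=\mathrm{diag}\Bigl(\frac{\log t+\log\theta_j}{\log q}\Bigr)_{j=1,2},\qquad D_\infty=\mathrm{diag}\Bigl(\frac{\log\kappa_j}{\log q}\Bigr)_{j=1,2},$$ be the canonical solutions of $Y(qx,t)=A(x,t)Y(x,t)$. Here $\widehat Y_0(\cdot,t)$ is meromorphic in $\mathbb C$ and holomorphic at $x=0$ with $\widehat Y_0(0,t)=C_0(t)$, and $\widehat Y_\infty(\cdot,t)$ is meromorphic in $\mathbb C\setminus\{0\}$ and holomorphic at $x=\infty$ with $\widehat Y_\infty(\infty,t)=I$. Define the connection matrix $P(x,t)$ by $Y_\infty(x,t)=Y_0(x,t)P(x,t)$. All identities below are between meromorphic functions of $\log x\in\mathbb C$. Then $P(x,qt)=P(x,t)$ for all $t$ with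 $t,qt\in T$ if and only if there is a matrix function $B_0(t)$, independent of $x$, such that for all $t$ with $t,qt\in T$ both $Y=Y_0$ and $Y=Y_\infty$ satisfy $$Y(x,qt)=B(x,t)\,Y(x,t),\qquad B(x,t)=\frac{x\,(xI+B_0(t))}{(x-qta_1)(x-qta_2)}.$$ -/

import Mathlib

open Filter

noncomputable section

namespace QPVI

/-- `2 × 2` complex matrices. -/
abbrev Mat := Matrix (Fin 2) (Fin 2) ℂ

/-- The quadratic coefficient matrix `A(x) = A₀ + A₁ x + A₂ x²` with `A₂ = diag(κ₁, κ₂)`. -/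
def coeff (κ : Fin 2 → ℂ) (A₀ A₁ : Mat) (x : ℂ) : Mat :=
  A₀ + x • A₁ + x ^ 2 • Matrix.diagonal κ

/-- The matrix power `x ^ D` for `D = diag(d₁, d₂)`, on the universal cover of `ℂ \ {0}`:
the point is given by a logarithm `ξ`, so that `x = exp ξ`. -/
def xPow (d : Fin 2 → ℂ) (ξ : ℂ) : Mat :=
  Matrix.diagonal fun j => Complex.exp (ξ * d j)

/-- `Y₀(x) = Ŷ₀(x) x ^ D₀`, as a function of `ξ = log x`. -/
def solZero (Yhat : ℂ → Mat) (d : Fin 2 → ℂ) (ξ : ℂ) : Mat :=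
  Yhat (Complex.exp ξ) * xPow d ξ

/-- `Y_∞(x) = q ^ (u (u - 1)) Ŷ_∞(x) x ^ D_∞` with `u = log x / log q`, as a function of
`ξ = log x`; here `lq` is the chosen value of `log q`, and the degree of `A` is `N = 2`, so that
`N / 2 = 1`. -/
def solInfty (lq : ℂ) (Yhat : ℂ → Mat) (d : Fin 2 → ℂ) (ξ : ℂ) : Mat :=
  Complex.exp (lq * ((ξ / lq) * (ξ / lq - 1))) • (Yhat (Complex.exp ξ) * xPow d ξ)

/-- `Y` solves `Y(qx) = A(x) Y(x)` as an identity of meromorphic functions of `ξ = log x`,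
that is, outside a closed discrete set of values of `ξ`. Passing from `x` to `qx` is passing
from `ξ` to `ξ + lq`. -/
def SolvesQDiff (lq : ℂ) (A : ℂ → Mat) (Y : ℂ → Mat) : Prop :=
  (fun ξ => Y (ξ + lq)) =ᶠ[codiscrete ℂ] fun ξ => A (Complex.exp ξ) * Y ξ

/-- `Ŷ` is the meromorphic factor of the canonical solution `Y₀ = Ŷ x ^ D`, `D = diag(d₁, d₂)`,
at `x = 0`: it is meromorphic in the plane, holomorphic at `0` with value the invertible
matrix `C`, and `Ŷ x ^ D` solves the `q`-difference system. -/
structure IsCanonicalZero (lq : ℂ) (A : ℂ → Mat) (C : Mat) (d : Fin 2 → ℂ)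
    (Yhat : ℂ → Mat) : Prop where
  meromorphic : ∀ i j, MeromorphicOn (fun x => Yhat x i j) Set.univ
  analyticAt_zero : ∀ i j, AnalyticAt ℂ (fun x => Yhat x i j) 0
  map_zero : Yhat 0 = C
  isUnit_det : IsUnit C.det
  solves : SolvesQDiff lq A (solZero Yhat d)

/-- `Ŷ` is the meromorphic factor of the canonical solution
`Y_∞ = q ^ (u (u - 1)) Ŷ x ^ D`, `D = diag(d₁, d₂)`, at `x = ∞`, normalized by `Ŷ(∞) = I`:
it is meromorphic in `0 < |x| < ∞`, the function `w ↦ Ŷ(1 / w)`, given the value `I` at `w = 0`,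
is holomorphic at `w = 0`, and `Y_∞` solves the `q`-difference system.
The value of `Ŷ` at `x = 0` plays no role. -/
structure IsCanonicalInfty (lq : ℂ) (A : ℂ → Mat) (d : Fin 2 → ℂ)
    (Yhat : ℂ → Mat) : Prop where
  meromorphic : ∀ i j, MeromorphicOn (fun x => Yhat x i j) {0}ᶜ
  analyticAt_infty : ∀ i j,
    AnalyticAt ℂ (fun w => (Function.update (fun w => Yhat w⁻¹) 0 (1 : Mat)) w i j) 0
  solves : SolvesQDiff lq A (solInfty lq Yhat d)

/-- The connection matrix `P = Y₀⁻¹ Y_∞`, defined by `Y_∞ = Y₀ P`. -/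
def connection (Y₀ Yinf : ℂ → Mat) (ξ : ℂ) : Mat := (Y₀ ξ)⁻¹ * Yinf ξ

/-- `B(x, t) = x (x I + B₀) / ((x - q t a₁) (x - q t a₂))`. -/
def deformB (q t a₁ a₂ : ℂ) (B₀ : Mat) (x : ℂ) : Mat :=
  (x / ((x - q * t * a₁) * (x - q * t * a₂))) • (x • (1 : Mat) + B₀)

/-- The exponents at `0`: the diagonal of `D₀(t) = diag(log (t θ_j) / log q)`, where
`log (t θ_j) = τ + log θ_j` and `τ = log t`. -/
def expZero (lq : ℂ) (logθ : Fin 2 → ℂ) (τ : ℂ) : Fin 2 → ℂ := fun j => (τ + logθ j) / lq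

/-- The exponents at `∞`: the diagonal of `D_∞ = diag(log κ_j / log q)`. -/
def expInfty (lq : ℂ) (logκ : Fin 2 → ℂ) : Fin 2 → ℂ := fun j => logκ j / lq

/-- The condition on the coefficients at one value of `t`:
`A₀ = C₀ diag(t θ₁, t θ₂) C₀⁻¹` (so `A₀` is semisimple with eigenvalues `t θ₁, t θ₂`) and
`det A(x) = κ₁ κ₂ (x - t a₁) (x - t a₂) (x - a₃) (x - a₄)`. -/
structure IsCoeffAt (κ θ : Fin 2 → ℂ) (a₁ a₂ a₃ a₄ : ℂ) (t : ℂ) (A₀ A₁ C₀ : Mat) : Prop where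
  isUnit_det : IsUnit C₀.det
  diagonalized : A₀ = C₀ * Matrix.diagonal (fun j => t * θ j) * C₀⁻¹
  det_eq : ∀ x : ℂ, (coeff κ A₀ A₁ x).det =
    κ 0 * κ 1 * (x - t * a₁) * (x - t * a₂) * (x - a₃) * (x - a₄)

/-- `z₁, z₂` are nonresonant: neither `z₁ / z₂` nor `z₂ / z₁` lies in `{q, q², q³, …}`. -/
def NonresonantExp (q : ℂ) (z : Fin 2 → ℂ) : Prop :=
  ∀ j k : Fin 2, ∀ n : ℕ, 1 ≤ n → z j / z k ≠ q ^ n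

/-- Genericity of the zeros `t a₁, t a₂, a₃, a₄` of `det A(x, t)` with respect to the shift
`t ↦ q t`. -/
structure GenericZeros (q a₁ a₂ a₃ a₄ t : ℂ) : Prop where
  moving : ∀ n : ℤ, 2 ≤ |n| → a₁ / a₂ ≠ q ^ n
  fixed : ∀ n : ℤ, n ≠ 0 → a₃ / a₄ ≠ q ^ n
  mixed : ∀ n : ℤ, n ≠ 0 → n ≠ -1 →
    t * a₁ / a₃ ≠ q ^ n ∧ t * a₁ / a₄ ≠ q ^ n ∧ t * a₂ / a₃ ≠ q ^ n ∧ t * a₂ / a₄ ≠ q ^ n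

end QPVI

end

open Topology

namespace QPVI

/-! ### Punctured neighbourhoods and the exponential map -/

/-! Write N = Ŷ₀(qt) Ŷ₀(t)⁻¹ and M = Ŷ∞(qt) Ŷ∞(t)⁻¹. Replacing t by qt raises both exponents at 0 by
one and leaves those at ∞ alone, so Y₀(qt) Y₀(t)⁻¹ = xN and Y∞(qt) Y∞(t)⁻¹ = M. Invariance of P
therefore says xN = M. In the converse direction B simply cancels from P.

Now N is analytic at 0, M is analytic near ∞ with limit I, and q N(qx) A(x,t) = A(x,qt) N(x).
Followed towards 0, this relation bounds the pole order of N at p by the number of zeros of det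
A(x,qt) among p, qp, q²p, …; followed towards ∞, by the number of zeros of det A(x/q,t) among p,
p/q, p/q², … (`PoleLE.of_qdiff`). Genericity makes the smaller of the two bounds at most the
multiplicity of p among qta₁, qta₂ (`card_orbit_min_le`). Hence (x - qta₁)(x - qta₂)N is entire.
Since xN → I, it grows like xI, and Liouville's theorem makes it xI + B₀ (`exists_eq_deformB`). -/

lemma eventually_codiscrete_iff {R : ℂ → Prop} :
    (∀ᶠ ξ in codiscrete ℂ, R ξ) ↔ ∀ ξ₀, ∀ᶠ ξ in 𝓝[≠] ξ₀, R ξ := by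
  simp only [Filter.Eventually, mem_codiscrete, disjoint_principal_right, compl_compl]

lemma map_nhdsNE_of_map_nhds {f : ℂ → ℂ} {f' a : ℂ} (hf : HasStrictDerivAt f f' a)
    (hf' : f' ≠ 0) : 𝓝[≠] (f a) ≤ map f (𝓝[≠] a) := by
  intro S hS
  rw [mem_map, mem_nhdsWithin_iff_eventually] at hS
  rw [mem_nhdsWithin_iff_eventually, ← hf.map_nhds_eq hf', eventually_map]
  have h2 : insert (f a) S ∈ map f (𝓝 a) := by
    rw [mem_map]
    filter_upwards [hS] with y hy
    by_cases h : y = a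
    · subst h; exact Set.mem_insert _ _
    · exact Set.mem_insert_of_mem _ (hy h)
  filter_upwards [h2] with y hy hne
  exact hy.resolve_left hne

/-- The exponential is a local homeomorphism onto ℂ \ {0}. This is the passage between identities in
ξ = log x and identities of single-valued functions of x. -/
lemma eventually_exp_iff {R : ℂ → Prop} :
    (∀ᶠ ξ in codiscrete ℂ, R (Complex.exp ξ)) ↔ ∀ p, p ≠ 0 → ∀ᶠ x in 𝓝[≠] p, R x := by
  rw [eventually_codiscrete_iff]
  constructor
  · intro h p hp
    obtain ⟨ξ, rfl⟩ : ∃ ξ, Complex.exp ξ = p := ⟨Complex.log p, Complex.exp_log hp⟩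
    exact map_nhdsNE_of_map_nhds (Complex.hasStrictDerivAt_exp ξ) (Complex.exp_ne_zero ξ) (h ξ)
  · intro h ξ
    exact ((Complex.hasDerivAt_exp ξ).tendsto_nhdsNE (Complex.exp_ne_zero ξ)).eventually
      (h _ (Complex.exp_ne_zero ξ))

lemma tendsto_const_mul_nhdsNE {s : ℂ} (hs : s ≠ 0) (p : ℂ) :
    Tendsto (fun x => s * x) (𝓝[≠] p) (𝓝[≠] (s * p)) := by
  have := ((hasDerivAt_id p).const_mul s).tendsto_nhdsNE (by simpa using hs)
  simpa using this

lemma eventually_nhdsNE_sub_ne_zero (p a : ℂ) : ∀ᶠ x in 𝓝[≠] p, x - a ≠ 0 := by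
  by_cases h : p = a
  · subst h
    filter_upwards [self_mem_nhdsWithin] with x hx
    exact sub_ne_zero.2 hx
  · filter_upwards [eventually_nhdsWithin_of_eventually_nhds (isOpen_ne.mem_nhds h)] with x hx
    exact sub_ne_zero.2 hx

/-! ### Gluing and Liouville -/

/-- For y near p the local extensions at y and at p agree on a punctured neighbourhood of y, hence
at y by continuity. So the diagonal values `g y y` coincide with `g p` near p. -/
lemma exists_entire_of_local {F : ℂ → ℂ}
    (h : ∀ p, ∃ g : ℂ → ℂ, AnalyticAt ℂ g p ∧ ∀ᶠ x in 𝓝[≠] p, F x = g x) :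
    ∃ G : ℂ → ℂ, Differentiable ℂ G ∧ ∀ p, ∀ᶠ x in 𝓝[≠] p, F x = G x := by
  choose g hg hFg using h
  have key : ∀ p, ∀ᶠ y in 𝓝 p, g y y = g p y := by
    intro p
    have h1 := eventually_nhdsWithin_iff.1 (eventually_eventually_nhdsWithin.2 (hFg p))
    filter_upwards [h1, (hg p).eventually_analyticAt] with y hy hay
    by_cases hyp : y = p
    · rw [hyp]
    · have hy1 : ∀ᶠ x in 𝓝[≠] y, F x = g p x := by
        have h2 := hy hyp
        rw [isOpen_compl_singleton.nhdsWithin_eq (by exact hyp)] at h2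
        exact eventually_nhdsWithin_of_eventually_nhds h2
      have h3 : ∀ᶠ x in 𝓝[≠] y, g y x = g p x := by
        filter_upwards [hy1, hFg y] with x h4 h5
        rw [← h4, h5]
      have l1 : Tendsto (g y) (𝓝[≠] y) (𝓝 (g y y)) :=
        (hg y).continuousAt.tendsto.mono_left nhdsWithin_le_nhds
      have l2 : Tendsto (g p) (𝓝[≠] y) (𝓝 (g p y)) :=
        hay.continuousAt.tendsto.mono_left nhdsWithin_le_nhds
      exact tendsto_nhds_unique (l1.congr' h3) l2
  refine ⟨fun p => g p p, fun p => ?_, fun p => ?_⟩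
  · exact ((hg p).congr (by filter_upwards [key p] with y hy using hy.symm)).differentiableAt
  · filter_upwards [hFg p, eventually_nhdsWithin_of_eventually_nhds (key p)] with x h1 h2
    rw [h1, h2]

/-- The slope (G(x) - G(0))/x extends to an entire function with limit c at infinity, so it is
constant by Liouville's theorem. -/
lemma eq_linear_of_tendsto {G : ℂ → ℂ} (hG : Differentiable ℂ G) {c : ℂ}
    (h : Tendsto (fun x => G x / x) (Bornology.cobounded ℂ) (𝓝 c)) (x : ℂ) :
    G x = x * c + G 0 := by
  have hd : Differentiable ℂ (dslope G 0) := by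
    rw [← differentiableOn_univ, Complex.differentiableOn_dslope univ_mem]
    exact hG.differentiableOn
  have hne : ∀ᶠ x : ℂ in Bornology.cobounded ℂ, x ≠ 0 := Bornology.eventually_ne_cobounded 0
  have ht : Tendsto (dslope G 0) (cocompact ℂ) (𝓝 c) := by
    rw [← Metric.cobounded_eq_cocompact]
    have h1 : Tendsto (fun x : ℂ => G x / x - G 0 * x⁻¹) (Bornology.cobounded ℂ)
        (𝓝 (c - G 0 * 0)) := h.sub (tendsto_inv₀_cobounded.const_mul _)
    rw [mul_zero, sub_zero] at h1
    refine h1.congr' ?_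
    filter_upwards [hne] with x hx
    rw [dslope_of_ne _ hx, slope_def_field]
    field_simp
    ring
  have hc := hd.apply_eq_of_tendsto_cocompact x ht
  by_cases hx : x = 0
  · simp [hx]
  · rw [dslope_of_ne _ hx, slope_def_field] at hc
    field_simp at hc
    rw [sub_zero] at hc
    linear_combination hc

/-! ### Matrix functions with analytic entries -/

/-- All entries of the matrix function `G` are analytic at `p`. -/
def AnalyticEntries (G : ℂ → Mat) (p : ℂ) : Prop := ∀ i j, AnalyticAt ℂ (fun x => G x i j) p

namespace AnalyticEntries

variable {G H : ℂ → Mat} {f : ℂ → ℂ} {p : ℂ}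

lemma mul (hG : AnalyticEntries G p) (hH : AnalyticEntries H p) :
    AnalyticEntries (fun x => G x * H x) p := by
  intro i j
  simp only [Matrix.mul_apply, Fin.sum_univ_two]
  exact ((hG i 0).mul (hH 0 j)).add ((hG i 1).mul (hH 1 j))

lemma smul (hf : AnalyticAt ℂ f p) (hG : AnalyticEntries G p) :
    AnalyticEntries (fun x => f x • G x) p := by
  intro i j
  simp only [Matrix.smul_apply, smul_eq_mul]
  exact hf.mul (hG i j)

lemma comp_const_mul (s : ℂ) (hG : AnalyticEntries G (s * p)) :
    AnalyticEntries (fun x => G (s * x)) p := by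
  intro i j
  exact (hG i j).comp_of_eq (analyticAt_const.mul analyticAt_id) rfl

lemma det (hG : AnalyticEntries G p) : AnalyticAt ℂ (fun x => (G x).det) p := by
  simp only [Matrix.det_fin_two]
  exact ((hG 0 0).mul (hG 1 1)).sub ((hG 0 1).mul (hG 1 0))

lemma adjugate (hG : AnalyticEntries G p) : AnalyticEntries (fun x => (G x).adjugate) p := by
  intro i j
  simp only [Matrix.adjugate_fin_two]
  fin_cases i <;> fin_cases j <;> simp
  · exact hG 1 1
  · exact (hG 0 1).neg
  · exact (hG 1 0).neg
  · exact hG 0 0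

lemma inv (hG : AnalyticEntries G p) (h : (G p).det ≠ 0) :
    AnalyticEntries (fun x => (G x)⁻¹) p := by
  simp only [Matrix.inv_def, Ring.inverse_eq_inv']
  exact smul (hG.det.inv h) hG.adjugate

end AnalyticEntries

lemma analyticEntries_coeff (κ : Fin 2 → ℂ) (A₀ A₁ : Mat) (p : ℂ) :
    AnalyticEntries (coeff κ A₀ A₁) p := by
  intro i j
  simp only [coeff, Matrix.add_apply, Matrix.smul_apply, smul_eq_mul]
  fun_prop

/-! ### Pole orders -/

/-- The matrix function `B` has at `p` a pole of order at most `k`. -/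
def PoleLE (B : ℂ → Mat) (p : ℂ) (k : ℕ) : Prop :=
  ∃ G : ℂ → Mat, AnalyticEntries G p ∧ ∀ᶠ x in 𝓝[≠] p, (x - p) ^ k • B x = G x

namespace PoleLE

variable {B : ℂ → Mat} {p : ℂ} {k l : ℕ}

lemma of_analytic {G : ℂ → Mat} (hG : AnalyticEntries G p) (h : ∀ᶠ x in 𝓝[≠] p, B x = G x) :
    PoleLE B p 0 :=
  ⟨G, hG, by simpa using h⟩

lemma mono (h : PoleLE B p k) (hkl : k ≤ l) : PoleLE B p l := by
  obtain ⟨G, hG, hB⟩ := h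
  refine ⟨fun x => (x - p) ^ (l - k) • G x,
    AnalyticEntries.smul ((analyticAt_id.sub analyticAt_const).pow _) hG, ?_⟩
  filter_upwards [hB] with x hx
  rw [← hx, smul_smul, ← pow_add, Nat.sub_add_cancel hkl]

lemma of_sub_smul {β : ℂ} (h : PoleLE (fun x => (x - β) • B x) p k) :
    PoleLE B p (k + if p = β then 1 else 0) := by
  obtain ⟨G, hG, hB⟩ := h
  split_ifs with hp
  · subst hp
    refine ⟨G, hG, ?_⟩
    filter_upwards [hB] with x hx
    rw [← hx, smul_smul, pow_succ]
  · refine ⟨fun x => (x - β)⁻¹ • G x, AnalyticEntries.smul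
      ((analyticAt_id.sub analyticAt_const).inv (sub_ne_zero.2 hp)) hG, ?_⟩
    filter_upwards [hB, eventually_nhdsNE_sub_ne_zero p β] with x hx hne
    rw [← hx, smul_smul, smul_smul, add_zero]
    congr 1
    field_simp

lemma of_prod_sub_smul {n : ℕ} (β : Fin n → ℂ)
    (h : PoleLE (fun x => (∏ j, (x - β j)) • B x) p k) :
    PoleLE B p (k + ∑ j, if p = β j then 1 else 0) := by
  induction n generalizing k with
  | zero => simpa using h
  | succ n ih =>
    rw [Fin.sum_univ_succ, ← add_assoc]
    refine ih (fun j => β j.succ) (of_sub_smul (β := β 0) ?_)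
    simpa only [smul_smul, Fin.prod_univ_succ] using h

lemma mul_comp {L R : ℂ → Mat} {s : ℂ} (hs : s ≠ 0) (hL : AnalyticEntries L p)
    (hR : AnalyticEntries R p) (h : PoleLE B (s * p) k) :
    PoleLE (fun x => L x * B (s * x) * R x) p k := by
  obtain ⟨G, hG, hB⟩ := h
  refine ⟨fun x => (s ^ k)⁻¹ • (L x * G (s * x) * R x), AnalyticEntries.smul analyticAt_const
    ((hL.mul (hG.comp_const_mul s)).mul hR), ?_⟩
  filter_upwards [(tendsto_const_mul_nhdsNE hs p).eventually hB] with x hx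
  rw [← hx, ← mul_sub, mul_pow, Matrix.mul_smul, Matrix.smul_mul, smul_smul, ← mul_assoc,
    inv_mul_cancel₀ (pow_ne_zero k hs), one_mul]

lemma congr {B' : ℂ → Mat} (h : PoleLE B p k) (h' : ∀ᶠ x in 𝓝[≠] p, B x = B' x) :
    PoleLE B' p k := by
  obtain ⟨G, hG, hB⟩ := h
  refine ⟨G, hG, ?_⟩
  filter_upwards [hB, h'] with x h1 h2
  rw [← h2, h1]

open Classical in
/-- If `∏ⱼ (x - βⱼ) B(x) = L(x) B(s x) R(x)` with `L`, `R` entire, and `B` is analytic far along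
the orbit `p, s p, s² p, …`, then the order of the pole of `B` at `p` is at most the number of
`βⱼ` on this orbit. -/
lemma of_qdiff {n : ℕ} {s : ℂ} (hs : s ≠ 0) (hs1 : ∀ n : ℕ, s ^ (n + 1) ≠ 1) (β : Fin n → ℂ)
    {L R : ℂ → Mat} (hL : ∀ p, AnalyticEntries L p) (hR : ∀ p, AnalyticEntries R p)
    (heq : ∀ p, p ≠ 0 → ∀ᶠ x in 𝓝[≠] p, (∏ j, (x - β j)) • B x = L x * B (s * x) * R x)
    (hp : p ≠ 0) (N : ℕ) (hN : PoleLE B (s ^ N * p) 0) :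
    PoleLE B p (∑ j, if ∃ n : ℕ, s ^ n * p = β j then 1 else 0) := by
  induction N generalizing p with
  | zero => exact mono (by simpa using hN) (Nat.zero_le _)
  -- The bound at sp passes to p through the equation; only the factors with βⱼ = p can add to it.
  | succ N ih =>
    have h1 := ih (mul_ne_zero hs hp) (by rwa [← mul_assoc, ← pow_succ])
    have h2 := ((h1.mul_comp hs (hL p) (hR p)).congr
      (by filter_upwards [heq p hp] with x hx using hx.symm)).of_prod_sub_smul
    refine h2.mono ?_
    rw [← Finset.sum_add_distrib]
    refine Finset.sum_le_sum fun j _ => ?_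
    have hiff : (∃ n : ℕ, s ^ n * p = β j) ↔ p = β j ∨ ∃ n : ℕ, s ^ n * (s * p) = β j := by
      constructor
      · rintro ⟨n, hn⟩
        cases n with
        | zero => left; simpa using hn
        | succ n => right; exact ⟨n, by rw [← hn]; ring⟩
      · rintro (h | ⟨n, hn⟩)
        · exact ⟨0, by simpa using h⟩
        · exact ⟨n + 1, by rw [← hn]; ring⟩
    -- The orbit never returns to p, so no βⱼ is counted twice.
    have hnot : ¬ (p = β j ∧ ∃ n : ℕ, s ^ n * (s * p) = β j) := by
      rintro ⟨h, n, hn⟩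
      refine hs1 n (mul_right_cancel₀ hp ?_)
      rw [one_mul, pow_succ, mul_assoc, hn, h]
    split_ifs <;> first | omega | (exfalso; tauto)

end PoleLE

/-! ### Counting zeros on `q`-orbits -/

section Counting

variable {q : ℂ}

lemma pow_succ_ne_one_of_norm_lt (hq : ‖q‖ < 1) (n : ℕ) : q ^ (n + 1) ≠ 1 := by
  intro h
  have h1 : ‖q‖ ^ (n + 1) = 1 := by rw [← norm_pow, h, norm_one]
  exact absurd h1 (pow_lt_one₀ (norm_nonneg q) hq (Nat.succ_ne_zero n)).ne

/-- The point p lies on the q-orbit between c and b, and N is the number of steps from c to b. With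
at most one step, p must be an endpoint. -/
lemma orbit_meet (hq0 : q ≠ 0) {p b c : ℂ} (hb : ∃ n : ℕ, q ^ n * p = b)
    (hc : ∃ n : ℕ, q⁻¹ ^ n * p = c) :
    ∃ N : ℕ, b = q ^ N * c ∧ (N = 0 → p = b ∧ p = c) ∧ (N = 1 → p = b ∨ p = c) := by
  obtain ⟨n, rfl⟩ := hb
  obtain ⟨m, rfl⟩ := hc
  refine ⟨n + m, ?_, ?_, ?_⟩
  · rw [inv_pow, pow_add]
    field_simp
  · intro h
    obtain ⟨rfl, rfl⟩ : n = 0 ∧ m = 0 := by omega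
    simp
  · intro h
    rcases (by omega : n = 0 ∨ m = 0) with rfl | rfl <;> simp

/-- Xᵢ and Zᵢ record zeros met towards 0 and towards ∞; E₁, E₂ say that p is a moving zero. A fixed
zero met on one side excludes fixed zeros on the other, and each moving zero met on that other side
must be p itself, so that side has the small count. With no fixed zeros, finitely many cases remain.
-/
lemma min_count_le {X₁ X₂ X₃ X₄ Z₁ Z₂ Z₃ Z₄ E₁ E₂ : Prop}
    {_ : Decidable X₁} {_ : Decidable X₂} {_ : Decidable X₃} {_ : Decidable X₄}
    {_ : Decidable Z₁} {_ : Decidable Z₂} {_ : Decidable Z₃} {_ : Decidable Z₄}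
    {_ : Decidable E₁} {_ : Decidable E₂}
    (m11 : X₁ → Z₁ → E₁) (m22 : X₂ → Z₂ → E₂) (m12 : X₁ → Z₂ → E₁ ∨ E₂) (m21 : X₂ → Z₁ → E₁ ∨ E₂)
    (m13 : (X₁ → Z₃ → E₁) ∧ (X₃ → Z₁ → E₁)) (m14 : (X₁ → Z₄ → E₁) ∧ (X₄ → Z₁ → E₁))
    (m23 : (X₂ → Z₃ → E₂) ∧ (X₃ → Z₂ → E₂)) (m24 : (X₂ → Z₄ → E₂) ∧ (X₄ → Z₂ → E₂))
    (m33 : X₃ → Z₃ → False) (m44 : X₄ → Z₄ → False)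
    (m34 : X₃ → Z₄ → False) (m43 : X₄ → Z₃ → False) :
    min ((if X₁ then 1 else 0) + (if X₂ then 1 else 0) + (if X₃ then 1 else 0) +
        (if X₄ then 1 else 0))
      ((if Z₁ then 1 else 0) + (if Z₂ then 1 else 0) + (if Z₃ then 1 else 0) +
        (if Z₄ then 1 else 0)) ≤ (if E₁ then 1 else 0) + (if E₂ then 1 else 0) := by
  have ite_mono : ∀ {P Q : Prop} {_ : Decidable P} {_ : Decidable Q}, (P → Q) →
      (if P then 1 else 0) ≤ (if Q then 1 else 0) := by
    intro P Q _ _ h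
    by_cases hP : P
    · simp [hP, h hP]
    · simp [hP]
  by_cases hX : X₃ ∨ X₄
  · have hZ₃ : ¬ Z₃ := fun z => hX.elim (m33 · z) (m43 · z)
    have hZ₄ : ¬ Z₄ := fun z => hX.elim (m34 · z) (m44 · z)
    refine (min_le_right _ _).trans ?_
    simp only [hZ₃, hZ₄, if_false, add_zero]
    exact add_le_add (ite_mono fun z => hX.elim (m13.2 · z) (m14.2 · z))
      (ite_mono fun z => hX.elim (m23.2 · z) (m24.2 · z))
  · obtain ⟨hX₃, hX₄⟩ := not_or.1 hX
    by_cases hZ : Z₃ ∨ Z₄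
    · refine (min_le_left _ _).trans ?_
      simp only [hX₃, hX₄, if_false, add_zero]
      exact add_le_add (ite_mono fun x => hZ.elim (m13.1 x) (m14.1 x))
        (ite_mono fun x => hZ.elim (m23.1 x) (m24.1 x))
    · obtain ⟨hZ₃, hZ₄⟩ := not_or.1 hZ
      simp only [hX₃, hX₄, hZ₃, hZ₄, if_false, add_zero]
      clear m13 m14 m23 m24 m33 m44 m34 m43
      by_cases hE₁ : E₁ <;> by_cases hE₂ : E₂ <;> by_cases hX₁ : X₁ <;> by_cases hX₂ : X₂ <;>
        by_cases hZ₁ : Z₁ <;> by_cases hZ₂ : Z₂ <;> simp_all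

open Classical in
-- The exponents that genericity still allows are harmless: a₁/a₂ = q^n with |n| ≤ 1 puts p at an
-- end of a segment of length at most one, while 0 and -1 in the mixed ratios correspond to N = 0 in
-- `orbit_meet`, where p is the moving zero. The fixed zeros appear as a₃, a₄ on one side and qa₃,
-- qa₄ on the other, hence the exponent N + 1.
lemma card_orbit_min_le (hq0 : q ≠ 0) (hq : ‖q‖ < 1) {t a₁ a₂ a₃ a₄ : ℂ} (ht : t ≠ 0)
    (h₁ : a₁ ≠ 0) (h₂ : a₂ ≠ 0) (h₃ : a₃ ≠ 0) (h₄ : a₄ ≠ 0)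
    (hgen : GenericZeros q a₁ a₂ a₃ a₄ t) (p : ℂ) :
    min (∑ j, if ∃ n : ℕ, q ^ n * p = ![q * t * a₁, q * t * a₂, a₃, a₄] j then 1 else 0)
      (∑ j, if ∃ n : ℕ, q⁻¹ ^ n * p = ![q * t * a₁, q * t * a₂, q * a₃, q * a₄] j then 1 else 0)
      ≤ (if p = q * t * a₁ then 1 else 0) + (if p = q * t * a₂ then 1 else 0) := by
  have hqt : q * t ≠ 0 := mul_ne_zero hq0 ht
  have same : ∀ a, a ≠ 0 → (∃ n : ℕ, q ^ n * p = q * t * a) →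
      (∃ n : ℕ, q⁻¹ ^ n * p = q * t * a) → p = q * t * a := by
    intro a ha hX hZ
    obtain ⟨N, hN, h0, -⟩ := orbit_meet hq0 hX hZ
    cases N with
    | zero => exact (h0 rfl).1
    | succ N =>
      refine absurd ?_ (pow_succ_ne_one_of_norm_lt hq N)
      exact mul_right_cancel₀ (mul_ne_zero hqt ha) (by rw [← hN, one_mul])
  have moving : ∀ a b, b ≠ 0 → (∀ N : ℕ, 2 ≤ N → a ≠ q ^ N * b) →
      (∃ n : ℕ, q ^ n * p = q * t * a) → (∃ n : ℕ, q⁻¹ ^ n * p = q * t * b) →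
      p = q * t * a ∨ p = q * t * b := by
    intro a b hb hab hX hZ
    obtain ⟨N, hN, h0, h1⟩ := orbit_meet hq0 hX hZ
    by_cases hN2 : 2 ≤ N
    · exact absurd (mul_left_cancel₀ hqt (by rw [hN]; ring)) (hab N hN2)
    · rcases (by omega : N = 0 ∨ N = 1) with h | h
      · exact Or.inl (h0 h).1
      · exact h1 h
  have mixed : ∀ a b, b ≠ 0 → (∀ n : ℤ, n ≠ 0 → n ≠ -1 → t * a / b ≠ q ^ n) →
      ((∃ n : ℕ, q ^ n * p = q * t * a) → (∃ n : ℕ, q⁻¹ ^ n * p = q * b) → p = q * t * a) ∧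
      ((∃ n : ℕ, q ^ n * p = b) → (∃ n : ℕ, q⁻¹ ^ n * p = q * t * a) → p = q * t * a) := by
    intro a b hb hab
    constructor
    · intro hX hZ
      obtain ⟨N, hN, h0, -⟩ := orbit_meet hq0 hX hZ
      by_cases hN0 : N = 0
      · exact (h0 hN0).1
      · refine absurd ?_ (hab N (by omega) (by omega))
        rw [zpow_natCast, div_eq_iff hb]
        exact mul_left_cancel₀ hq0 (by rw [← mul_assoc, hN]; ring)
    · intro hX hZ
      obtain ⟨N, hN, h0, -⟩ := orbit_meet hq0 hX hZ
      by_cases hN0 : N = 0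
      · exact (h0 hN0).2
      · refine absurd ?_ (hab (-((N : ℤ) + 1)) (by omega) (by omega))
        rw [zpow_neg, zpow_add_one₀ hq0, zpow_natCast, div_eq_iff hb, hN]
        field_simp
  have fixed : ∀ a b, b ≠ 0 → (∀ N : ℕ, a ≠ q ^ (N + 1) * b) →
      (∃ n : ℕ, q ^ n * p = a) → (∃ n : ℕ, q⁻¹ ^ n * p = q * b) → False := by
    intro a b hb hab hX hZ
    obtain ⟨N, hN, -, -⟩ := orbit_meet hq0 hX hZ
    exact hab N (by rw [hN]; ring)
  have fixed_same : ∀ b, b ≠ 0 → ∀ N : ℕ, b ≠ q ^ (N + 1) * b := fun b hb N h =>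
    pow_succ_ne_one_of_norm_lt hq N (mul_right_cancel₀ hb (by rw [← h, one_mul]))
  have m11 := same a₁ h₁
  have m22 := same a₂ h₂
  have m12 := moving a₁ a₂ h₂ fun N hN h => hgen.moving N (by simpa using hN) (by
    rw [zpow_natCast, div_eq_iff h₂, h])
  have m21 := moving a₂ a₁ h₁ fun N hN h => hgen.moving (-N) (by simpa using hN) (by
    rw [zpow_neg, zpow_natCast, h]
    field_simp)
  have m13 := mixed a₁ a₃ h₃ fun n h0 h1 => (hgen.mixed n h0 h1).1
  have m14 := mixed a₁ a₄ h₄ fun n h0 h1 => (hgen.mixed n h0 h1).2.1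
  have m23 := mixed a₂ a₃ h₃ fun n h0 h1 => (hgen.mixed n h0 h1).2.2.1
  have m24 := mixed a₂ a₄ h₄ fun n h0 h1 => (hgen.mixed n h0 h1).2.2.2
  have m33 := fixed a₃ a₃ h₃ (fixed_same a₃ h₃)
  have m44 := fixed a₄ a₄ h₄ (fixed_same a₄ h₄)
  have m34 := fixed a₃ a₄ h₄ fun N h => hgen.fixed (N + 1) (by omega) (by
    rw [zpow_add_one₀ hq0, zpow_natCast, div_eq_iff h₄, h, pow_succ])
  have m43 := fixed a₄ a₃ h₃ fun N h => hgen.fixed (-((N : ℤ) + 1)) (by omega) (by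
    rw [zpow_neg, zpow_add_one₀ hq0, zpow_natCast, h, pow_succ]
    field_simp)
  simp only [Fin.sum_univ_four, Matrix.cons_val]
  exact min_count_le m11 m22 m12 (fun h h' => (m21 h h').symm) m13 m14 m23 m24 m33 m44 m34 m43

end Counting

/-! ### The deformation matrix -/

section Deformation

lemma exists_pow_mul_mem {q : ℂ} (hq : ‖q‖ < 1) {R : ℂ → Prop} (h : ∀ᶠ x in 𝓝 0, R x) (p : ℂ) :
    ∃ N : ℕ, R (q ^ N * p) := by
  have h1 : Tendsto (fun N : ℕ => q ^ N * p) atTop (𝓝 0) := by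
    simpa using (tendsto_pow_atTop_nhds_zero_of_norm_lt_one hq).mul_const p
  exact (h1.eventually h).exists

lemma exists_inv_pow_mul_mem {q : ℂ} (hq0 : q ≠ 0) (hq : ‖q‖ < 1) {R : ℂ → Prop}
    (h : ∀ᶠ x in Bornology.cobounded ℂ, R x) {p : ℂ} (hp : p ≠ 0) :
    ∃ N : ℕ, R (q⁻¹ ^ N * p) := by
  have h1 : Tendsto (fun N : ℕ => q ^ N * p⁻¹) atTop (𝓝[≠] 0) := by
    refine tendsto_nhdsWithin_iff.2 ⟨?_, Eventually.of_forall fun N =>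
      mul_ne_zero (pow_ne_zero N hq0) (inv_ne_zero hp)⟩
    simpa using (tendsto_pow_atTop_nhds_zero_of_norm_lt_one hq).mul_const p⁻¹
  have h2 := (tendsto_inv₀_nhdsNE_zero (α := ℂ)).comp h1
  obtain ⟨N, hN⟩ := (h2.eventually h).exists
  exact ⟨N, by simpa [mul_comm] using hN⟩

variable {q t a₁ a₂ a₃ a₄ c : ℂ} {A A' N M : ℂ → Mat}

lemma poleLE_zero_of_qdiff (hq0 : q ≠ 0) (hq : ‖q‖ < 1) (hc : c ≠ 0) (ht : t ≠ 0)
    (h₁ : a₁ ≠ 0) (h₂ : a₂ ≠ 0) (h₃ : a₃ ≠ 0) (h₄ : a₄ ≠ 0)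
    (hgen : GenericZeros q a₁ a₂ a₃ a₄ t)
    (hA : ∀ p, AnalyticEntries A p) (hA' : ∀ p, AnalyticEntries A' p)
    (hdet : ∀ x, (A x).det = c * (x - t * a₁) * (x - t * a₂) * (x - a₃) * (x - a₄))
    (hdet' : ∀ x, (A' x).det = c * (x - q * t * a₁) * (x - q * t * a₂) * (x - a₃) * (x - a₄))
    (hN0 : AnalyticEntries N 0)
    (hM : ∀ᶠ x in Bornology.cobounded ℂ, AnalyticEntries M x)
    (hNM : ∀ p, p ≠ 0 → ∀ᶠ x in 𝓝[≠] p, x • N x = M x)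
    (heq : ∀ p, p ≠ 0 → ∀ᶠ x in 𝓝[≠] p, q • (N (q * x) * A x) = A' x * N x)
    {p : ℂ} (hp : p ≠ 0) :
    PoleLE (fun x => ((x - q * t * a₁) * (x - q * t * a₂)) • N x) p 0 := by
  classical
  have hin : PoleLE N p (∑ j, if ∃ n : ℕ, q ^ n * p = ![q * t * a₁, q * t * a₂, a₃, a₄] j
      then 1 else 0) := by
    obtain ⟨n, hn⟩ := exists_pow_mul_mem hq (eventually_all.2 fun i => eventually_all.2 fun j =>
      (hN0 i j).eventually_analyticAt) p
    refine PoleLE.of_qdiff hq0 (pow_succ_ne_one_of_norm_lt hq) _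
      (L := fun x => (q / c) • (A' x).adjugate) (R := A)
      (fun p => AnalyticEntries.smul analyticAt_const (hA' p).adjugate) hA (fun p hp => ?_) hp n
      (PoleLE.of_analytic (G := N) hn (Eventually.of_forall fun _ => rfl))
    filter_upwards [heq p hp] with x hx
    have h5 : (q / c) • ((A' x).adjugate * (N (q * x) * A x))
        = c⁻¹ • ((A' x).adjugate * (q • (N (q * x) * A x))) := by
      rw [Matrix.mul_smul, smul_smul, div_eq_inv_mul]
    rw [Matrix.smul_mul, Matrix.smul_mul, Matrix.mul_assoc, h5, hx, ← Matrix.mul_assoc,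
      Matrix.adjugate_mul, hdet', Matrix.smul_mul, Matrix.one_mul, smul_smul]
    congr 1
    simp only [Fin.prod_univ_four, Matrix.cons_val]
    field_simp
  have hout : PoleLE N p (∑ j, if ∃ n : ℕ,
      q⁻¹ ^ n * p = ![q * t * a₁, q * t * a₂, q * a₃, q * a₄] j then 1 else 0) := by
    obtain ⟨n, hn⟩ := exists_inv_pow_mul_mem hq0 hq hM hp
    have hqi : q⁻¹ ≠ 0 := inv_ne_zero hq0
    have hne : q⁻¹ ^ n * p ≠ 0 := mul_ne_zero (pow_ne_zero n hqi) hp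
    have hs : ∀ n : ℕ, q⁻¹ ^ (n + 1) ≠ 1 := fun n h =>
      pow_succ_ne_one_of_norm_lt hq n (by rwa [inv_pow, inv_eq_one] at h)
    refine PoleLE.of_qdiff hqi hs _
      -- The equation is taken at x/q and solved for N(x). Clearing the four denominators in det
      -- A(x/q) gives q⁴, and the factor q in the equation takes one power away.
      (L := fun x => (q ^ 3 / c) • A' (q⁻¹ * x)) (R := fun x => (A (q⁻¹ * x)).adjugate)
      (fun p => AnalyticEntries.smul analyticAt_const (hA' _).comp_const_mul)
      (fun p => ((hA _).comp_const_mul _).adjugate) (fun p hp => ?_) hp n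
      (PoleLE.of_analytic (G := fun x => x⁻¹ • M x)
        (AnalyticEntries.smul (analyticAt_id.inv hne) hn) ?_)
    · filter_upwards [(tendsto_const_mul_nhdsNE hqi p).eventually
        (heq _ (mul_ne_zero hqi hp))] with x hx
      rw [mul_inv_cancel_left₀ hq0] at hx
      rw [Matrix.smul_mul, Matrix.smul_mul, ← hx, Matrix.smul_mul, Matrix.mul_assoc,
        Matrix.mul_adjugate, hdet, Matrix.mul_smul, Matrix.mul_one, smul_smul, smul_smul]
      congr 1
      simp only [Fin.prod_univ_four, Matrix.cons_val]
      field_simp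
    · filter_upwards [hNM _ hne, eventually_nhdsNE_sub_ne_zero _ 0] with x hx hx0
      rw [sub_zero] at hx0
      rw [← hx, smul_smul, inv_mul_cancel₀ hx0, one_smul]
  have hmin : PoleLE N p ((if p = q * t * a₁ then 1 else 0) +
      (if p = q * t * a₂ then 1 else 0)) := by
    refine PoleLE.mono ?_ (card_orbit_min_le hq0 hq ht h₁ h₂ h₃ h₄ hgen p)
    rcases min_choice (∑ j, if ∃ n : ℕ, q ^ n * p = ![q * t * a₁, q * t * a₂, a₃, a₄] j
      then 1 else 0) (∑ j, if ∃ n : ℕ, q⁻¹ ^ n * p = ![q * t * a₁, q * t * a₂, q * a₃, q * a₄] j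
      then 1 else 0) with h | h <;> rw [h]
    exacts [hin, hout]
  -- The two factors are used one at a time, so a double pole when a₁ = a₂ is covered.
  have hmul : ∀ (B : ℂ → Mat) (β : ℂ) (k : ℕ), PoleLE B p ((if p = β then 1 else 0) + k) →
      PoleLE (fun x => (x - β) • B x) p k := by
    rintro B β k ⟨G, hG, hB⟩
    split_ifs at hB with h
    · subst h
      refine ⟨G, hG, ?_⟩
      filter_upwards [hB] with x hx
      rw [← hx, smul_smul, add_comm, pow_succ]
    · refine ⟨fun x => (x - β) • G x,
        AnalyticEntries.smul (analyticAt_id.sub analyticAt_const) hG, ?_⟩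
      filter_upwards [hB] with x hx
      rw [← hx, smul_smul, smul_smul, zero_add, mul_comm]
  have h6 := hmul _ (q * t * a₂) 0 (hmul N _ _ hmin)
  refine h6.congr (Eventually.of_forall fun x => ?_)
  simp only [smul_smul]
  rw [mul_comm]

lemma exists_eq_deformB (hq0 : q ≠ 0) (hq : ‖q‖ < 1) (hc : c ≠ 0) (ht : t ≠ 0)
    (h₁ : a₁ ≠ 0) (h₂ : a₂ ≠ 0) (h₃ : a₃ ≠ 0) (h₄ : a₄ ≠ 0)
    (hgen : GenericZeros q a₁ a₂ a₃ a₄ t)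
    (hA : ∀ p, AnalyticEntries A p) (hA' : ∀ p, AnalyticEntries A' p)
    (hdet : ∀ x, (A x).det = c * (x - t * a₁) * (x - t * a₂) * (x - a₃) * (x - a₄))
    (hdet' : ∀ x, (A' x).det = c * (x - q * t * a₁) * (x - q * t * a₂) * (x - a₃) * (x - a₄))
    (hN0 : AnalyticEntries N 0)
    (hM : ∀ᶠ x in Bornology.cobounded ℂ, AnalyticEntries M x)
    (hM1 : ∀ i j, Tendsto (fun x => M x i j) (Bornology.cobounded ℂ) (𝓝 ((1 : Mat) i j)))
    (hNM : ∀ p, p ≠ 0 → ∀ᶠ x in 𝓝[≠] p, x • N x = M x)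
    (heq : ∀ p, p ≠ 0 → ∀ᶠ x in 𝓝[≠] p, q • (N (q * x) * A x) = A' x * N x) :
    ∃ B₀ : Mat, ∀ p, p ≠ 0 → ∀ᶠ x in 𝓝[≠] p, x • N x = deformB q t a₁ a₂ B₀ x := by
  have hloc : ∀ i j, ∃ G : ℂ → ℂ, Differentiable ℂ G ∧ ∀ p, ∀ᶠ x in 𝓝[≠] p,
      (x - q * t * a₁) * (x - q * t * a₂) * N x i j = G x := by
    intro i j
    refine exists_entire_of_local fun p => ?_
    by_cases hp : p = 0
    · subst hp
      exact ⟨fun x => (x - q * t * a₁) * (x - q * t * a₂) * N x i j,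
        ((analyticAt_id.sub analyticAt_const).mul (analyticAt_id.sub analyticAt_const)).mul
          (hN0 i j), Eventually.of_forall fun _ => rfl⟩
    · obtain ⟨G, hG, hNG⟩ := poleLE_zero_of_qdiff hq0 hq hc ht h₁ h₂ h₃ h₄ hgen hA hA' hdet hdet'
        hN0 hM hNM heq hp
      refine ⟨fun x => G x i j, hG i j, ?_⟩
      filter_upwards [hNG] with x hx
      rw [← hx]
      simp
  choose G hGd hG using hloc
  have hlim : ∀ i j, Tendsto (fun x => G i j x / x) (Bornology.cobounded ℂ)
      (𝓝 ((1 : Mat) i j)) := by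
    intro i j
    have hfac : ∀ b : ℂ, Tendsto (fun x : ℂ => 1 - b * x⁻¹) (Bornology.cobounded ℂ) (𝓝 1) := by
      intro b
      simpa using (tendsto_inv₀_cobounded (α := ℂ)).const_mul b |>.const_sub 1
    have h5 := ((hfac (q * t * a₁)).mul (hfac (q * t * a₂))).mul (hM1 i j)
    rw [one_mul, one_mul] at h5
    refine h5.congr' ?_
    filter_upwards [hM, Bornology.eventually_ne_cobounded (0 : ℂ)] with p hMp hp
    have l1 : Tendsto (G i j) (𝓝[≠] p) (𝓝 (G i j p)) :=
      (hGd i j).continuous.continuousAt.tendsto.mono_left nhdsWithin_le_nhds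
    have l2 : Tendsto (fun x => (x - q * t * a₁) * (x - q * t * a₂) * (x⁻¹ * M x i j)) (𝓝[≠] p)
        (𝓝 ((p - q * t * a₁) * (p - q * t * a₂) * (p⁻¹ * M p i j))) := by
      refine Tendsto.mono_left (ContinuousAt.tendsto ?_) nhdsWithin_le_nhds
      have hMc : ContinuousAt (fun x => M x i j) p := (hMp i j).continuousAt
      fun_prop (disch := assumption)
    -- `hNM` and `hG` hold only off isolated points; continuity of both sides gives equality at p
    -- itself, as the limit at infinity requires.
    have h7 : G i j p = (p - q * t * a₁) * (p - q * t * a₂) * (p⁻¹ * M p i j) := by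
      refine tendsto_nhds_unique l1 (l2.congr' ?_)
      filter_upwards [hNM p hp, hG i j p, eventually_nhdsNE_sub_ne_zero p 0] with x hx hGx hx0
      rw [sub_zero] at hx0
      rw [← hGx, ← hx, Matrix.smul_apply, smul_eq_mul, inv_mul_cancel_left₀ hx0]
    rw [h7]
    field_simp
  refine ⟨Matrix.of fun i j => G i j 0, fun p hp => ?_⟩
  have hall : ∀ᶠ x in 𝓝[≠] p, ∀ i j,
      (x - q * t * a₁) * (x - q * t * a₂) * N x i j = G i j x :=
    eventually_all.2 fun i => eventually_all.2 fun j => hG i j p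
  filter_upwards [hall, eventually_nhdsNE_sub_ne_zero p (q * t * a₁),
    eventually_nhdsNE_sub_ne_zero p (q * t * a₂)] with x hx hb₁ hb₂
  ext i j
  have h8 := hx i j
  rw [eq_linear_of_tendsto (hGd i j) (hlim i j) x] at h8
  simp only [deformB, Matrix.smul_apply, Matrix.add_apply, Matrix.of_apply, smul_eq_mul]
  rw [← h8]
  field_simp

end Deformation

/-! ### Canonical solutions -/

/-- Identity theorem: on a connected set the order is finite everywhere once it is finite at one
point. It makes the canonical solutions generically invertible. -/
lemma eventually_ne_zero_of_meromorphicOn {f : ℂ → ℂ} {U : Set ℂ} (hf : MeromorphicOn f U)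
    (hU : IsConnected U) {u : ℂ} (hu : u ∈ U) (hfu : ∀ᶠ x in 𝓝 u, f x ≠ 0) {p : ℂ}
    (hp : p ∈ U) : ∀ᶠ x in 𝓝[≠] p, f x ≠ 0 := by
  have h := (hf.exists_meromorphicOrderAt_ne_top_iff_forall hU).1
    ⟨⟨u, hu⟩, (meromorphicOrderAt_ne_top_iff_eventually_ne_zero (hf u hu)).2
      (eventually_nhdsWithin_of_eventually_nhds hfu)⟩
  exact (meromorphicOrderAt_ne_top_iff_eventually_ne_zero (hf p hp)).1 (h ⟨p, hp⟩)

lemma meromorphicOn_det {Y : ℂ → Mat} {U : Set ℂ}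
    (h : ∀ i j, MeromorphicOn (fun x => Y x i j) U) : MeromorphicOn (fun x => (Y x).det) U := by
  simp only [Matrix.det_fin_two]
  exact ((h 0 0).mul (h 1 1)).sub ((h 0 1).mul (h 1 0))

lemma det_xPow_ne_zero (d : Fin 2 → ℂ) (ξ : ℂ) : (xPow d ξ).det ≠ 0 := by
  simp [xPow, Complex.exp_ne_zero]

lemma mul_mul_inv_mul_right (Y Y' : Mat) {Z : Mat} (hZ : Z.det ≠ 0) :
    (Y' * Z) * (Y * Z)⁻¹ = Y' * Y⁻¹ := by
  rw [Matrix.mul_inv_rev, Matrix.mul_assoc,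
    Matrix.mul_nonsing_inv_cancel_left _ _ (isUnit_iff_ne_zero.2 hZ)]

/-- Each exponent (τ + log θⱼ)/log q grows by one; this is the source of the factor x in the
numerator of B. -/
lemma xPow_expZero_add {lq : ℂ} (hlq : lq ≠ 0) (logθ : Fin 2 → ℂ) (τ ξ : ℂ) :
    xPow (expZero lq logθ (τ + lq)) ξ = Complex.exp ξ • xPow (expZero lq logθ τ) ξ := by
  have h : ∀ j, ξ * expZero lq logθ (τ + lq) j = ξ + ξ * expZero lq logθ τ j := by
    intro j
    simp only [expZero]
    field_simp
    ring
  simp only [xPow, h, Complex.exp_add]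
  rw [← Matrix.diagonal_smul]
  rfl

lemma solZero_mul_inv {lq : ℂ} (hlq : lq ≠ 0) (logθ : Fin 2 → ℂ) (V V' : ℂ → Mat) (τ ξ : ℂ) :
    solZero V' (expZero lq logθ (τ + lq)) ξ * (solZero V (expZero lq logθ τ) ξ)⁻¹ =
      Complex.exp ξ • (V' (Complex.exp ξ) * (V (Complex.exp ξ))⁻¹) := by
  rw [solZero, solZero, xPow_expZero_add hlq, Matrix.mul_smul, Matrix.smul_mul,
    mul_mul_inv_mul_right _ _ (det_xPow_ne_zero _ _)]

lemma solInfty_mul_inv (lq : ℂ) (d : Fin 2 → ℂ) (V V' : ℂ → Mat) (ξ : ℂ) :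
    solInfty lq V' d ξ * (solInfty lq V d ξ)⁻¹ =
      V' (Complex.exp ξ) * (V (Complex.exp ξ))⁻¹ := by
  rw [solInfty, solInfty, ← Matrix.mul_smul, ← Matrix.mul_smul, mul_mul_inv_mul_right]
  rw [Matrix.det_smul]
  exact mul_ne_zero (pow_ne_zero _ (Complex.exp_ne_zero _)) (det_xPow_ne_zero _ _)

lemma IsCanonicalZero.eventually_det_ne_zero {lq : ℂ} {A : ℂ → Mat} {C : Mat} {d : Fin 2 → ℂ}
    {V : ℂ → Mat} (h : IsCanonicalZero lq A C d V) (p : ℂ) :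
    ∀ᶠ x in 𝓝[≠] p, (V x).det ≠ 0 := by
  refine eventually_ne_zero_of_meromorphicOn (meromorphicOn_det h.meromorphic) isConnected_univ
    (Set.mem_univ 0) ?_ (Set.mem_univ p)
  have hV : AnalyticEntries V 0 := h.analyticAt_zero
  exact hV.det.continuousAt.eventually_ne (by rw [h.map_zero]; exact h.isUnit_det.ne_zero)

lemma IsCanonicalZero.solZero_det_ne_zero {lq : ℂ} {A : ℂ → Mat} {C : Mat} {d : Fin 2 → ℂ}
    {V : ℂ → Mat} (h : IsCanonicalZero lq A C d V) :
    ∀ᶠ ξ in codiscrete ℂ, (solZero V d ξ).det ≠ 0 := by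
  filter_upwards [eventually_exp_iff.2 fun p _ => h.eventually_det_ne_zero p] with ξ hξ
  rw [solZero, Matrix.det_mul]
  exact mul_ne_zero hξ (det_xPow_ne_zero _ _)

namespace IsCanonicalInfty

variable {lq : ℂ} {A : ℂ → Mat} {d : Fin 2 → ℂ} {V : ℂ → Mat}

lemma eventually_analyticEntries (h : IsCanonicalInfty lq A d V) :
    ∀ᶠ x in Bornology.cobounded ℂ, AnalyticEntries V x := by
  have h1 : ∀ᶠ w in 𝓝[≠] (0 : ℂ), ∀ i j,
      AnalyticAt ℂ (fun w => (Function.update (fun w => V w⁻¹) 0 (1 : Mat)) w i j) w :=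
    eventually_nhdsWithin_of_eventually_nhds (eventually_all.2 fun i => eventually_all.2 fun j =>
      (h.analyticAt_infty i j).eventually_analyticAt)
  filter_upwards [tendsto_inv₀_cobounded'.eventually h1,
    Bornology.eventually_ne_cobounded (0 : ℂ)] with x hx hx0 i j
  refine ((hx i j).comp_of_eq (analyticAt_inv hx0) rfl).congr ?_
  filter_upwards [isOpen_ne.mem_nhds hx0] with y hy
  simp only [Function.comp_apply]
  rw [Function.update_of_ne (inv_ne_zero hy), inv_inv]

lemma tendsto_entry (h : IsCanonicalInfty lq A d V) (i j : Fin 2) :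
    Tendsto (fun x => V x i j) (Bornology.cobounded ℂ) (𝓝 ((1 : Mat) i j)) := by
  have h1 := (h.analyticAt_infty i j).continuousAt.tendsto.comp tendsto_inv₀_cobounded
  simp only [Function.update_self] at h1
  refine h1.congr' ?_
  filter_upwards [Bornology.eventually_ne_cobounded (0 : ℂ)] with x hx
  simp only [Function.comp_apply]
  rw [Function.update_of_ne (inv_ne_zero hx), inv_inv]

lemma tendsto (h : IsCanonicalInfty lq A d V) : Tendsto V (Bornology.cobounded ℂ) (𝓝 1) :=
  tendsto_pi_nhds.2 fun i => tendsto_pi_nhds.2 fun j => h.tendsto_entry i j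

lemma tendsto_det (h : IsCanonicalInfty lq A d V) :
    Tendsto (fun x => (V x).det) (Bornology.cobounded ℂ) (𝓝 1) := by
  have h1 := (continuous_id.matrix_det (n := Fin 2) (R := ℂ)).continuousAt.tendsto.comp h.tendsto
  simpa [Function.comp_def] using h1

lemma eventually_det_ne_zero (h : IsCanonicalInfty lq A d V) {p : ℂ} (hp : p ≠ 0) :
    ∀ᶠ x in 𝓝[≠] p, (V x).det ≠ 0 := by
  obtain ⟨u, hu0, hua, hud⟩ := ((Bornology.eventually_ne_cobounded (0 : ℂ)).and
    (h.eventually_analyticEntries.and (h.tendsto_det.eventually_ne one_ne_zero))).exists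
  exact eventually_ne_zero_of_meromorphicOn (meromorphicOn_det h.meromorphic)
    (isConnected_compl_singleton_of_one_lt_rank (by simp) 0) hu0
    (hua.det.continuousAt.eventually_ne hud) hp

lemma solInfty_det_ne_zero (h : IsCanonicalInfty lq A d V) :
    ∀ᶠ ξ in codiscrete ℂ, (solInfty lq V d ξ).det ≠ 0 := by
  filter_upwards [eventually_exp_iff.2 fun p hp => h.eventually_det_ne_zero hp] with ξ hξ
  rw [solInfty, Matrix.det_smul, Matrix.det_mul]
  exact mul_ne_zero (pow_ne_zero _ (Complex.exp_ne_zero _))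
    (mul_ne_zero hξ (det_xPow_ne_zero _ _))

end IsCanonicalInfty

/-- At x = 0 the determinant is t²θ₁θ₂ ≠ 0, so no zero of det A sits at the origin. -/
lemma IsCoeffAt.parameters_ne_zero {κ θ : Fin 2 → ℂ} {a₁ a₂ a₃ a₄ t : ℂ} {A₀ A₁ C₀ : Mat}
    (h : IsCoeffAt κ θ a₁ a₂ a₃ a₄ t A₀ A₁ C₀) (ht : t ≠ 0) (hθ : ∀ j, θ j ≠ 0) :
    a₁ ≠ 0 ∧ a₂ ≠ 0 ∧ a₃ ≠ 0 ∧ a₄ ≠ 0 := by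
  have h1 := h.det_eq 0
  have h2 : (coeff κ A₀ A₁ 0).det ≠ 0 := by
    have h3 : coeff κ A₀ A₁ 0 = A₀ := by simp [coeff]
    rw [h3, h.diagonalized, Matrix.det_mul, Matrix.det_mul, Matrix.det_diagonal,
      Fin.prod_univ_two]
    exact mul_ne_zero (mul_ne_zero h.isUnit_det.ne_zero
      (mul_ne_zero (mul_ne_zero ht (hθ 0)) (mul_ne_zero ht (hθ 1))))
      (Matrix.isUnit_nonsing_inv_det _ h.isUnit_det).ne_zero
  rw [h1] at h2
  refine ⟨?_, ?_, ?_, ?_⟩ <;> rintro rfl <;> simp at h2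

/-- The quotient `N = Ŷ₀(qt) Ŷ₀(t)⁻¹` satisfies `q N(qx) A(x, t) = A(x, qt) N(x)`. -/
lemma IsCanonicalZero.quotient_qdiff {lq : ℂ} (hlq : lq ≠ 0) {A A' : ℂ → Mat} {C C' : Mat}
    {logθ : Fin 2 → ℂ} {τ : ℂ} {V V' : ℂ → Mat}
    (h : IsCanonicalZero lq A C (expZero lq logθ τ) V)
    (h' : IsCanonicalZero lq A' C' (expZero lq logθ (τ + lq)) V')
    (hdet : ∀ p, ∀ᶠ x in 𝓝[≠] p, (A x).det ≠ 0) {p : ℂ} (hp : p ≠ 0) :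
    ∀ᶠ x in 𝓝[≠] p, Complex.exp lq • (V' (Complex.exp lq * x) * (V (Complex.exp lq * x))⁻¹ * A x)
      = A' x * (V' x * (V x)⁻¹) := by
  refine eventually_exp_iff.1 ?_ p hp
  have hs := h.solves
  have hs' := h'.solves
  filter_upwards [hs, hs', eventually_exp_iff.2 fun p _ => hdet p] with ξ h1 h2 h3
  have h4 := solZero_mul_inv hlq logθ V V' τ (ξ + lq)
  have h5 := solZero_mul_inv hlq logθ V V' τ ξ
  rw [h1, h2, Matrix.mul_inv_rev, Matrix.mul_assoc, ← Matrix.mul_assoc (solZero V' _ ξ), h5,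
    Complex.exp_add] at h4
  have h6 := congrArg (fun Z => Z * A (Complex.exp ξ)) h4
  simp only [Matrix.mul_assoc, Matrix.smul_mul, Matrix.mul_smul,
    Matrix.nonsing_inv_mul _ (isUnit_iff_ne_zero.2 h3), Matrix.mul_one, mul_smul] at h6
  have h7 := smul_right_injective Mat (Complex.exp_ne_zero ξ) h6
  simp only [Matrix.mul_assoc]
  rw [mul_comm (Complex.exp lq)]
  exact h7.symm

lemma mul_inv_eq_of_inv_mul_eq {Y Y' Z Z' : Mat} (hY' : Y'.det ≠ 0)
    (hZ : Z.det ≠ 0) (h : Y'⁻¹ * Z' = Y⁻¹ * Z) : Z' * Z⁻¹ = Y' * Y⁻¹ := by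
  have h1 : Z' = Y' * (Y⁻¹ * Z) := by
    rw [← h, Matrix.mul_nonsing_inv_cancel_left _ _ (isUnit_iff_ne_zero.2 hY')]
  rw [h1, ← Matrix.mul_assoc, Matrix.mul_nonsing_inv_cancel_right _ _ (isUnit_iff_ne_zero.2 hZ)]

end QPVI


/-! ### Invariance of the connection matrix and the deformation equation -/

theorem proposition2
    -- `q` with a choice `lq` of `log q`
    (q lq : ℂ) (hlq : Complex.exp lq = q) (hq : ‖q‖ < 1)
    -- the parameters, independent of `t`, with choices of `log κ_j`, `log θ_j`
    (κ θ logκ logθ : Fin 2 → ℂ)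
    (hκ : ∀ j, Complex.exp (logκ j) = κ j) (hθ : ∀ j, Complex.exp (logθ j) = θ j)
    (hκres : QPVI.NonresonantExp q κ) (hθres : QPVI.NonresonantExp q θ)
    (a₁ a₂ a₃ a₄ : ℂ)
    -- the set of values `τ = log t` on which the family of systems is given
    (T : Set ℂ)
    (A₀ A₁ C₀ : ℂ → QPVI.Mat)
    (hA : ∀ τ ∈ T, QPVI.IsCoeffAt κ θ a₁ a₂ a₃ a₄ (Complex.exp τ) (A₀ τ) (A₁ τ) (C₀ τ))
    (hgen : ∀ τ ∈ T, τ + lq ∈ T → QPVI.GenericZeros q a₁ a₂ a₃ a₄ (Complex.exp τ))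
    -- the canonical solutions
    (Yhat₀ Yhatinf : ℂ → ℂ → QPVI.Mat)
    (hY₀ : ∀ τ ∈ T, QPVI.IsCanonicalZero lq (QPVI.coeff κ (A₀ τ) (A₁ τ)) (C₀ τ)
      (QPVI.expZero lq logθ τ) (Yhat₀ τ))
    (hYinf : ∀ τ ∈ T, QPVI.IsCanonicalInfty lq (QPVI.coeff κ (A₀ τ) (A₁ τ))
      (QPVI.expInfty lq logκ) (Yhatinf τ))
    (Y₀ Yinf P : ℂ → ℂ → QPVI.Mat)
    (hY₀_def : ∀ τ, Y₀ τ = QPVI.solZero (Yhat₀ τ) (QPVI.expZero lq logθ τ))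
    (hYinf_def : ∀ τ, Yinf τ = QPVI.solInfty lq (Yhatinf τ) (QPVI.expInfty lq logκ))
    (hP_def : ∀ τ, P τ = QPVI.connection (Y₀ τ) (Yinf τ)) :
    (∀ τ ∈ T, τ + lq ∈ T → P (τ + lq) =ᶠ[Filter.codiscrete ℂ] P τ) ↔
    ∃ B₀ : ℂ → QPVI.Mat, ∀ τ ∈ T, τ + lq ∈ T → ∀ Y ∈ ({Y₀, Yinf} : Set (ℂ → ℂ → QPVI.Mat)),
      Y (τ + lq) =ᶠ[Filter.codiscrete ℂ] fun ξ =>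
        QPVI.deformB q (Complex.exp τ) a₁ a₂ (B₀ τ) (Complex.exp ξ) * Y τ ξ := by
  have hq0 : q ≠ 0 := hlq ▸ Complex.exp_ne_zero lq
  have hlq0 : lq ≠ 0 := by
    rintro rfl
    rw [← hlq, Complex.exp_zero, norm_one] at hq
    exact lt_irrefl _ hq
  have hκ0 : ∀ j, κ j ≠ 0 := fun j => hκ j ▸ Complex.exp_ne_zero _
  have hθ0 : ∀ j, θ j ≠ 0 := fun j => hθ j ▸ Complex.exp_ne_zero _
  constructor
  · intro hP
    have key : ∀ τ, ∃ B₀ : QPVI.Mat, τ ∈ T → τ + lq ∈ T →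
        ∀ Y ∈ ({Y₀, Yinf} : Set (ℂ → ℂ → QPVI.Mat)),
          Y (τ + lq) =ᶠ[Filter.codiscrete ℂ] fun ξ =>
            QPVI.deformB q (Complex.exp τ) a₁ a₂ B₀ (Complex.exp ξ) * Y τ ξ := by
      intro τ
      by_cases hτ : τ ∈ T ∧ τ + lq ∈ T
      swap
      · exact ⟨0, fun h h' => absurd ⟨h, h'⟩ hτ⟩
      obtain ⟨hτ, hτ'⟩ := hτ
      have ht : Complex.exp τ ≠ 0 := Complex.exp_ne_zero τ
      obtain ⟨h₁, h₂, h₃, h₄⟩ := (hA τ hτ).parameters_ne_zero ht hθ0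
      have hc : κ 0 * κ 1 ≠ 0 := mul_ne_zero (hκ0 0) (hκ0 1)
      have hdet := (hA τ hτ).det_eq
      have hdet' := (hA _ hτ').det_eq
      rw [Complex.exp_add, hlq, mul_comm _ q] at hdet'
      have hZ := hY₀ τ hτ
      have hZ' := hY₀ _ hτ'
      have hI := hYinf τ hτ
      have hI' := hYinf _ hτ'
      have hdet_ne : ∀ p, ∀ᶠ x in 𝓝[≠] p, (QPVI.coeff κ (A₀ τ) (A₁ τ) x).det ≠ 0 := by
        intro p
        filter_upwards [QPVI.eventually_nhdsNE_sub_ne_zero p (Complex.exp τ * a₁),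
          QPVI.eventually_nhdsNE_sub_ne_zero p (Complex.exp τ * a₂),
          QPVI.eventually_nhdsNE_sub_ne_zero p a₃,
          QPVI.eventually_nhdsNE_sub_ne_zero p a₄] with x e₁ e₂ e₃ e₄
        rw [hdet]
        exact mul_ne_zero (mul_ne_zero (mul_ne_zero (mul_ne_zero hc e₁) e₂) e₃) e₄
      have hquot : ∀ᶠ ξ in codiscrete ℂ,
          Yinf (τ + lq) ξ * (Yinf τ ξ)⁻¹ = Y₀ (τ + lq) ξ * (Y₀ τ ξ)⁻¹ := by
        filter_upwards [hP τ hτ hτ', hZ'.solZero_det_ne_zero, hI.solInfty_det_ne_zero]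
          with ξ e e' e''
        rw [← hY₀_def] at e'
        rw [← hYinf_def] at e''
        simp only [hP_def, QPVI.connection] at e
        exact QPVI.mul_inv_eq_of_inv_mul_eq e' e'' e
      have hNM : ∀ p, p ≠ 0 → ∀ᶠ x in 𝓝[≠] p, x • (Yhat₀ (τ + lq) x * (Yhat₀ τ x)⁻¹) =
          Yhatinf (τ + lq) x * (Yhatinf τ x)⁻¹ := by
        refine QPVI.eventually_exp_iff.1 ?_
        filter_upwards [hquot] with ξ e
        rw [hY₀_def, hY₀_def, hYinf_def, hYinf_def, QPVI.solInfty_mul_inv,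
          QPVI.solZero_mul_inv hlq0] at e
        exact e.symm
      have hMan : ∀ᶠ x in Bornology.cobounded ℂ, QPVI.AnalyticEntries
          (fun x => Yhatinf (τ + lq) x * (Yhatinf τ x)⁻¹) x := by
        filter_upwards [hI.eventually_analyticEntries, hI'.eventually_analyticEntries,
          hI.tendsto_det.eventually_ne one_ne_zero] with x e e' e''
        exact e'.mul (e.inv e'')
      have hMlim : ∀ i j, Tendsto (fun x => (Yhatinf (τ + lq) x * (Yhatinf τ x)⁻¹) i j)
          (Bornology.cobounded ℂ) (𝓝 ((1 : QPVI.Mat) i j)) := by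
        have hadj : Tendsto (fun x => (Yhatinf τ x).adjugate) (Bornology.cobounded ℂ) (𝓝 1) := by
          have := (continuous_id.matrix_adjugate (n := Fin 2) (R := ℂ)).continuousAt.tendsto.comp
            hI.tendsto
          simpa [Function.comp_def] using this
        have hlim : Tendsto (fun x => Yhatinf (τ + lq) x * (Yhatinf τ x)⁻¹)
            (Bornology.cobounded ℂ) (𝓝 1) := by
          simp only [Matrix.inv_def, Ring.inverse_eq_inv']
          have := hI'.tendsto.mul ((hI.tendsto_det.inv₀ one_ne_zero).smul hadj)
          simpa using this
        exact fun i j => tendsto_pi_nhds.1 (tendsto_pi_nhds.1 hlim i) j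
      have hN0 : QPVI.AnalyticEntries (fun x => Yhat₀ (τ + lq) x * (Yhat₀ τ x)⁻¹) 0 := by
        have e : QPVI.AnalyticEntries (Yhat₀ τ) 0 := hZ.analyticAt_zero
        have e' : QPVI.AnalyticEntries (Yhat₀ (τ + lq)) 0 := hZ'.analyticAt_zero
        exact e'.mul (e.inv (by rw [hZ.map_zero]; exact hZ.isUnit_det.ne_zero))
      obtain ⟨B₀, hB₀⟩ := QPVI.exists_eq_deformB hq0 hq hc ht h₁ h₂ h₃ h₄ (hgen τ hτ hτ')
        (QPVI.analyticEntries_coeff κ (A₀ τ) (A₁ τ))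
        (QPVI.analyticEntries_coeff κ (A₀ (τ + lq)) (A₁ (τ + lq))) hdet hdet' hN0 hMan hMlim hNM
        (fun p hp => by
          have := hZ.quotient_qdiff hlq0 hZ' hdet_ne hp
          rwa [hlq] at this)
      have hB : ∀ᶠ ξ in codiscrete ℂ, Y₀ (τ + lq) ξ * (Y₀ τ ξ)⁻¹ =
          QPVI.deformB q (Complex.exp τ) a₁ a₂ B₀ (Complex.exp ξ) := by
        filter_upwards [QPVI.eventually_exp_iff.2 hB₀] with ξ e
        rw [hY₀_def, hY₀_def, QPVI.solZero_mul_inv hlq0, e]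
      refine ⟨B₀, fun _ _ Y hY => ?_⟩
      rcases hY with rfl | rfl
      · filter_upwards [hB, hZ.solZero_det_ne_zero] with ξ e e'
        rw [← hY₀_def] at e'
        rw [← e, Matrix.nonsing_inv_mul_cancel_right _ _ (isUnit_iff_ne_zero.2 e')]
      · filter_upwards [hB, hquot, hI.solInfty_det_ne_zero] with ξ e e' e''
        rw [← hYinf_def] at e''
        rw [← e, ← e', Matrix.nonsing_inv_mul_cancel_right _ _ (isUnit_iff_ne_zero.2 e'')]
    choose B₀ hB₀ using key
    exact ⟨B₀, fun τ hτ hτ' Y hY => hB₀ τ hτ hτ' Y hY⟩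
  · rintro ⟨B₀, hB⟩ τ hτ hτ'
    filter_upwards [hB τ hτ hτ' Y₀ (by simp), hB τ hτ hτ' Yinf (by simp),
      (hY₀ _ hτ').solZero_det_ne_zero] with ξ e e' e''
    -- Invertibility of Y₀(qt) = B Y₀(t) forces det B ≠ 0, which allows B to cancel.
    rw [← hY₀_def, e, Matrix.det_mul] at e''
    rw [hP_def, hP_def, QPVI.connection, QPVI.connection, e, e', Matrix.mul_inv_rev,
      Matrix.mul_assoc, Matrix.nonsing_inv_mul_cancel_left _ _
        (isUnit_iff_ne_zero.2 (left_ne_zero_of_mul e''))]
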